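/- Proposition. Let $d,n\ge 0$ and $T\ge 1$ be integers, $\mathcal Z$ a set, and $\ell:\mathbb R^d\times\mathcal Z\to\mathbb R$ a loss such that for every $z\in\mathcal Z$ the function $\ell(\cdot,z)$ is convex, differentiable, satisfies $\|\nabla_w\ell(w,z)\|_2\le G$ for all $w$, and has an $L$-Lipschitz gradient ($L\ge 0$). Let $\eta>0$ with $\eta L\le 2$, $\beta_0>0$, $\lambda_t=\frac1{t\eta}$, and $\alpha\in(1,\infty)$. Given a data set $S=(z_1,\dots,z_n)\in\mathcal Z^n$, single-pass SGLD (DP-SGD) draws $w_1\sim N(0,\beta_0 I)$ and then, for $t=2,\dots,T$, uses a mini-batch $B_t\subseteq\{1,\dots,n\}$ of size $$|B_t|=\left\lceil\sqrt{\frac{T}{2(T-t+1)}}\,\right\rceil$$ and samples $$w_t\sim N\Big((1-\lambda_t\eta)\Big(w_{t-1}-\frac{\eta}{|B_t|}\sum_{i\in B_t}\nabla_w\ell(w_{t-1},z_i)\Big),\ \lambda_t\eta(2-\lambda_t\eta)\beta_0 I\Big).$$ The mini-batches $B_2,\dots,B_T$ are pairwise disjoint (single pass); the sequence $(B_2,\dots,B_T)$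 is fixed or drawn at random from any distribution on such sequences, independently of the data and of the Gaussian noise. Then the last iterate $w_T$ is $(\alpha,\epsilon)$-Rényi differentially private with $$\epsilon=\frac{2\alpha\eta^2G^2}{\beta_0}.$$ That is, if $\mu_S$ denotes the law of $w_T$ on the data set $S$ (a probability measure), then $D_\alpha(\mu_S\|\mu_{S'})\le\epsilon$ for all $S,S'\in\mathcal Z^n$ that differ in at most one item, where $D_\alpha(\mu\|\nu)=\frac1{\alpha-1}\log\int\big(\frac{d\mu}{d\nu}\big)^\alpha d\nu$ if $\mu\ll\nu$ and $D_\alpha(\mu\|\nu)=\infty$ otherwise. -/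

import Mathlib

open MeasureTheory ProbabilityTheory
open scoped ENNReal NNReal

noncomputable section

namespace SGLD

/-- The isotropic Gaussian `N(m, v I)` on `ℝ^d`. -/
def gaussian {d : ℕ} (m : EuclideanSpace ℝ (Fin d)) (v : ℝ) :
    Measure (EuclideanSpace ℝ (Fin d)) :=
  multivariateGaussian m (v • (1 : Matrix (Fin d) (Fin d) ℝ))

/-- The mini-batch gradient `(1/|B|) ∑_{i ∈ B} ∇ℓ(w, z_i)`. -/
def batchGradient {d n : ℕ} {Z : Type*} (ℓ : EuclideanSpace ℝ (Fin d) → Z → ℝ)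
    (S : Fin n → Z) (B : Finset (Fin n)) (w : EuclideanSpace ℝ (Fin d)) :
    EuclideanSpace ℝ (Fin d) :=
  (B.card : ℝ)⁻¹ • ∑ i ∈ B, gradient (fun u => ℓ u (S i)) w

/-- One iteration: given the previous iterate `w`, the conditional law of the new iterate,
`N((1 - λη)(w - η g(w)), λη(2 - λη) β₀ I)`, where `g` is the gradient on the mini-batch `B`. -/
def stepLaw {d n : ℕ} {Z : Type*} (ℓ : EuclideanSpace ℝ (Fin d) → Z → ℝ)
    (S : Fin n → Z) (β₀ η lam : ℝ) (B : Finset (Fin n)) (w : EuclideanSpace ℝ (Fin d)) :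
    Measure (EuclideanSpace ℝ (Fin d)) :=
  gaussian ((1 - lam * η) • (w - η • batchGradient ℓ S B w))
    (lam * η * (2 - lam * η) * β₀)

/-- The law of the iterate `w_{k+1}` when iteration `t` uses step size `η t`, regularization
`lam t` and the mini-batch `M t`: `w_1 ~ N(0, β₀ I)`, and `w_t` is drawn from `w_{t-1}` by
iteration `t` for `t ≥ 2`. -/
def iterateLaw {d n : ℕ} {Z : Type*} (ℓ : EuclideanSpace ℝ (Fin d) → Z → ℝ)
    (S : Fin n → Z) (β₀ : ℝ) (η lam : ℕ → ℝ) (M : ℕ → Finset (Fin n)) :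
    ℕ → Measure (EuclideanSpace ℝ (Fin d))
  | 0 => gaussian 0 β₀
  | k + 1 => (iterateLaw ℓ S β₀ η lam M k).bind
      (stepLaw ℓ S β₀ (η (k + 2)) (lam (k + 2)) (M (k + 2)))

/-- A mini-batch schedule: a set of indices of data points for every iteration `t = 2, …, T`. -/
abbrev Schedule (T n : ℕ) : Type := Finset.Icc 2 T → Finset (Fin n)

/-- The mini-batch of iteration `t` (the value outside `2, …, T` is never used). -/
def Schedule.batch {T n : ℕ} (M : Schedule T n) (t : ℕ) : Finset (Fin n) :=
  if h : t ∈ Finset.Icc 2 T then M ⟨t, h⟩ else ∅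

/-- Single-pass schedules with the prescribed sizes: no data point is used in two iterations,
and the mini-batch of iteration `t` has `⌈√(T / (2 (T - t + 1)))⌉` elements. -/
def Schedule.IsSinglePass {T n : ℕ} (M : Schedule T n) : Prop :=
  (∀ s t, s ≠ t → Disjoint (M s) (M t)) ∧
  ∀ t : Finset.Icc 2 T,
    (M t).card = ⌈Real.sqrt ((T : ℝ) / (2 * ((T : ℝ) - ((t : ℕ) : ℝ) + 1)))⌉₊

/-- The law of the last iterate `w_T` on the data set `S`, when the mini-batch schedule is drawn
from `P`, independently of the data and of the Gaussian noise. -/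
def lastIterateLaw {d n : ℕ} {Z : Type*} (ℓ : EuclideanSpace ℝ (Fin d) → Z → ℝ)
    (β₀ : ℝ) (η lam : ℕ → ℝ) (T : ℕ) (P : PMF (Schedule T n)) (S : Fin n → Z) :
    Measure (EuclideanSpace ℝ (Fin d)) :=
  ∑ M : Schedule T n, P M • iterateLaw ℓ S β₀ η lam M.batch (T - 1)

open Classical in
/-- Rényi divergence of order `α`, for `1 < α < ∞`:
`(α - 1)⁻¹ log ∫ (dμ/dν)^α dν` if `μ ≪ ν`, and `∞` otherwise. -/
def renyiDiv {X : Type*} [MeasurableSpace X] (α : ℝ) (μ ν : Measure X) : EReal :=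
  if μ ≪ ν then
    (((α - 1)⁻¹ : ℝ) : EReal) * ENNReal.log (∫⁻ x, (μ.rnDeriv ν x) ^ α ∂ν)
  else ⊤

/-- Neighboring data sets: they differ in at most one item. -/
def Neighboring {n : ℕ} {Z : Type*} (S S' : Fin n → Z) : Prop :=
  {i | S i ≠ S' i}.ncard ≤ 1

/-- `(α, ε)`-Rényi differential privacy of a randomized algorithm on data sets of size `n`, given
by its output law on each data set. -/
def IsRenyiDP {n : ℕ} {Z X : Type*} [MeasurableSpace X] (α ε : ℝ)
    (A : (Fin n → Z) → Measure X) : Prop :=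
  (∀ S, IsProbabilityMeasure (A S)) ∧
  ∀ S S', Neighboring S S' → renyiDiv α (A S) (A S') ≤ (ε : EReal)

end SGLD

end

/-! By duality, a bound `ε` on the Rényi divergence of `μ` from `ν` is the inequality
`(∫ f ∂μ) ^ r ≤ exp ε * ∫ f ^ r ∂ν` for all `f ≥ 0`, with `r` conjugate to `α`. In this form the
bounds add up under composition of kernels and pass to mixtures, hence to random schedules.

For the noise kernel the inequality is Wang's power Harnack inequality
`(κ f x) ^ r ≤ exp (α * ‖x - y‖ ^ 2 / (2 * V)) * κ (f ^ r) y`. Convexity and smoothness make the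
gradient steps nonexpansive, so running the kernel after a contracted gradient step with fresh
Gaussian noise preserves the inequality, and the variances add up as if no gradients were present.
Since `1 - λ_t η = (t - 1) / t`, the contraction factors from iteration `t` to the last one
telescope to `(t - 1) / T`, which gives `V = β₀ * ((T / (t - 1)) ^ 2 - 1)`.

In a single pass only one iteration `t` sees the item in which the data sets differ. The two
gradient steps then differ by at most `2 * η * G / |B_t|`, and the noise from iteration `t` on
absorbs this shift at the cost `α * (2 * η * G / |B_t|) ^ 2 / (2 * V)`. The prescribed size of `B_t`
keeps the cost below `2 * α * η ^ 2 * G ^ 2 / β₀` for every `t`.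
-/

namespace SGLD

section ConvexSmooth

variable {E : Type*} [NormedAddCommGroup E] [InnerProductSpace ℝ E] [CompleteSpace E]
  {f : E → ℝ} {L : ℝ≥0}

open scoped RealInnerProductSpace

lemma hasDerivAt_comp_add_smul {x v : E} {t : ℝ} (hf : DifferentiableAt ℝ f (x + t • v)) :
    HasDerivAt (fun s : ℝ => f (x + s • v)) ⟪gradient f (x + t • v), v⟫ t := by
  have hline : HasDerivAt (fun s : ℝ => x + s • v) v t := by
    simpa using ((hasDerivAt_id t).smul_const v).const_add x
  exact hf.hasGradientAt.hasFDerivAt.comp_hasDerivAt t hline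

lemma add_inner_gradient_le_of_convexOn (hconv : ConvexOn ℝ Set.univ f) {x : E}
    (hf : DifferentiableAt ℝ f x) (y : E) : f x + ⟪gradient f x, y - x⟫ ≤ f y := by
  have hline : ConvexOn ℝ Set.univ fun t : ℝ => f (x + t • (y - x)) :=
    (hconv.comp_affineMap (AffineMap.lineMap x y)).congr fun t _ => by
      simp [AffineMap.lineMap_apply, add_comm]
  have hderiv := hasDerivAt_comp_add_smul (f := f) (x := x) (v := y - x) (t := 0)
    (by simpa using hf)
  have hslope := hline.le_slope_of_hasDerivAt (Set.mem_univ 0) (Set.mem_univ 1) one_pos hderiv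
  simp only [zero_smul, add_zero, slope_def_field, one_smul, add_sub_cancel, sub_zero,
    div_one] at hslope
  linarith

lemma le_add_inner_gradient_add_of_lipschitzWith (hf : Differentiable ℝ f)
    (hL : LipschitzWith L (gradient f)) (x y : E) :
    f y ≤ f x + ⟪gradient f x, y - x⟫ + L / 2 * ‖y - x‖ ^ 2 := by
  obtain ⟨v, rfl⟩ : ∃ v, y = x + v := ⟨y - x, by abel⟩
  rw [add_sub_cancel_left]
  let φ : ℝ → ℝ := fun t => f (x + t • v) - t * ⟪gradient f x, v⟫ - L / 2 * ‖v‖ ^ 2 * t ^ 2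
  have hφ (t : ℝ) : HasDerivAt φ
      (⟪gradient f (x + t • v), v⟫ - ⟪gradient f x, v⟫ - L / 2 * ‖v‖ ^ 2 * (2 * t)) t := by
    exact (((hasDerivAt_comp_add_smul (hf (x + t • v))).sub
      ((hasDerivAt_id t).mul_const ⟪gradient f x, v⟫)).sub
      ((hasDerivAt_pow 2 t).const_mul (L / 2 * ‖v‖ ^ 2))).congr_deriv
      (by simp only [one_mul, Nat.cast_ofNat, Nat.add_one_sub_one, pow_one])
  have hφ_nonpos (t : ℝ) (ht : 0 < t) :
      ⟪gradient f (x + t • v), v⟫ - ⟪gradient f x, v⟫ - L / 2 * ‖v‖ ^ 2 * (2 * t) ≤ 0 := by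
    have hgrad : ‖gradient f (x + t • v) - gradient f x‖ ≤ L * (t * ‖v‖) := by
      simpa [dist_eq_norm, norm_smul, abs_of_pos ht] using hL.dist_le_mul (x + t • v) x
    have hinner := real_inner_le_norm (gradient f (x + t • v) - gradient f x) v
    rw [inner_sub_left] at hinner
    nlinarith [mul_le_mul_of_nonneg_right hgrad (norm_nonneg v)]
  have hanti : AntitoneOn φ (Set.Icc 0 1) :=
    antitoneOn_of_hasDerivWithinAt_nonpos (convex_Icc 0 1)
      (fun t _ => (hφ t).continuousAt.continuousWithinAt) (fun t _ => (hφ t).hasDerivWithinAt)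
      fun t ht => hφ_nonpos t (interior_Icc (a := (0 : ℝ)) ▸ ht).1
  have hend := hanti (Set.left_mem_Icc.2 zero_le_one) (Set.right_mem_Icc.2 zero_le_one) zero_le_one
  simp only [φ, one_smul, zero_smul, add_zero] at hend
  linarith

/- The two bounds on `f (y - s • g)`, from the tangent plane at `x` and from the quadratic upper
bound at `y`, where `g` is the difference of the gradients, are compared at the optimal
`s = 1 / L`. -/
lemma sq_norm_gradient_sub_le_of_convexOn (hconv : ConvexOn ℝ Set.univ f)
    (hf : Differentiable ℝ f) (hL : LipschitzWith L (gradient f)) (x y : E) :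
    ‖gradient f y - gradient f x‖ ^ 2 ≤ 2 * L * (f y - f x - ⟪gradient f x, y - x⟫) := by
  rcases eq_or_ne L 0 with rfl | hL0
  · simpa [dist_eq_norm] using hL.dist_le_mul y x
  have hL_pos : (0 : ℝ) < L := by exact_mod_cast pos_iff_ne_zero.2 hL0
  set g := gradient f y - gradient f x
  have hlower := add_inner_gradient_le_of_convexOn hconv (hf x) (y - (L : ℝ)⁻¹ • g)
  have hupper := le_add_inner_gradient_add_of_lipschitzWith hf hL y (y - (L : ℝ)⁻¹ • g)
  rw [sub_right_comm, inner_sub_right, inner_smul_right] at hlower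
  rw [sub_sub_cancel_left, inner_neg_right, inner_smul_right, norm_neg, norm_smul, norm_inv,
    Real.norm_of_nonneg hL_pos.le] at hupper
  have hinner : ⟪gradient f y, g⟫ - ⟪gradient f x, g⟫ = ‖g‖ ^ 2 := by
    rw [← inner_sub_left, real_inner_self_eq_norm_sq]
  have hgap : (L : ℝ)⁻¹ * ‖g‖ ^ 2 - L / 2 * ((L : ℝ)⁻¹ * ‖g‖) ^ 2
      ≤ f y - f x - ⟪gradient f x, y - x⟫ := by
    rw [← hinner]; linarith
  calc ‖g‖ ^ 2 = 2 * L * ((L : ℝ)⁻¹ * ‖g‖ ^ 2 - L / 2 * ((L : ℝ)⁻¹ * ‖g‖) ^ 2) := by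
        field_simp; ring
    _ ≤ 2 * L * (f y - f x - ⟪gradient f x, y - x⟫) := by gcongr

lemma sq_norm_gradient_sub_le_inner (hconv : ConvexOn ℝ Set.univ f)
    (hf : Differentiable ℝ f) (hL : LipschitzWith L (gradient f)) (x y : E) :
    ‖gradient f x - gradient f y‖ ^ 2 ≤ L * ⟪gradient f x - gradient f y, x - y⟫ := by
  have hxy := sq_norm_gradient_sub_le_of_convexOn hconv hf hL x y
  have hyx := sq_norm_gradient_sub_le_of_convexOn hconv hf hL y x
  rw [norm_sub_rev, ← neg_sub x y, inner_neg_right] at hxy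
  rw [inner_sub_left]
  linarith

lemma inner_gradient_sub_nonneg (hconv : ConvexOn ℝ Set.univ f) (hf : Differentiable ℝ f)
    (x y : E) : 0 ≤ ⟪gradient f x - gradient f y, x - y⟫ := by
  have hxy := add_inner_gradient_le_of_convexOn hconv (hf x) y
  have hyx := add_inner_gradient_le_of_convexOn hconv (hf y) x
  rw [← neg_sub x y, inner_neg_right] at hxy
  rw [inner_sub_left]
  linarith

lemma lipschitzWith_one_sub_smul_gradient (hconv : ConvexOn ℝ Set.univ f)
    (hf : Differentiable ℝ f) (hL : LipschitzWith L (gradient f)) {η : ℝ} (hη : 0 ≤ η)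
    (hηL : η * L ≤ 2) : LipschitzWith 1 fun x => x - η • gradient f x := by
  refine LipschitzWith.of_dist_le_mul fun x y => ?_
  rw [NNReal.coe_one, one_mul, dist_eq_norm, dist_eq_norm, sub_sub_sub_comm, ← smul_sub]
  have hcoercive := sq_norm_gradient_sub_le_inner hconv hf hL x y
  have hmono := inner_gradient_sub_nonneg hconv hf x y
  rw [← sq_le_sq₀ (norm_nonneg _) (norm_nonneg _), norm_sub_sq_real, inner_smul_right,
    norm_smul, mul_pow, Real.norm_of_nonneg hη, real_inner_comm]
  nlinarith [mul_le_mul_of_nonneg_left hcoercive (sq_nonneg η),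
    mul_le_mul_of_nonneg_right hηL (mul_nonneg hη hmono)]

end ConvexSmooth

section BatchGradient

variable {d n : ℕ} {Z : Type*} {ℓ : EuclideanSpace ℝ (Fin d) → Z → ℝ}

lemma lipschitzWith_one_sub_smul_batchGradient {η : ℝ}
    (hstep : ∀ z, LipschitzWith 1 fun w => w - η • gradient (fun u => ℓ u z) w)
    (S : Fin n → Z) (B : Finset (Fin n)) :
    LipschitzWith 1 fun w => w - η • batchGradient ℓ S B w := by
  rcases B.eq_empty_or_nonempty with rfl | hB
  · simp only [batchGradient, Finset.sum_empty, smul_zero, sub_zero]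
    exact LipschitzWith.id
  have hcard : (0 : ℝ) < B.card := by exact_mod_cast hB.card_pos
  have hmean (w : EuclideanSpace ℝ (Fin d)) : w - η • batchGradient ℓ S B w
      = (B.card : ℝ)⁻¹ • ∑ i ∈ B, (w - η • gradient (fun u => ℓ u (S i)) w) := by
    rw [Finset.sum_sub_distrib, ← Finset.smul_sum, smul_sub, batchGradient,
      smul_comm, Finset.sum_const, ← Nat.cast_smul_eq_nsmul ℝ, inv_smul_smul₀ hcard.ne']
  refine LipschitzWith.of_dist_le_mul fun x y => ?_
  rw [NNReal.coe_one, one_mul, dist_eq_norm, dist_eq_norm, hmean, hmean, ← smul_sub,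
    ← Finset.sum_sub_distrib, norm_smul, norm_inv, Real.norm_of_nonneg hcard.le,
    inv_mul_le_iff₀ hcard]
  calc ‖∑ i ∈ B, (x - η • gradient (fun u => ℓ u (S i)) x
        - (y - η • gradient (fun u => ℓ u (S i)) y))‖
      ≤ ∑ _i ∈ B, ‖x - y‖ := norm_sum_le_of_le B fun i _ => by
        simpa [dist_eq_norm] using (hstep (S i)).dist_le_mul x y
    _ = B.card * ‖x - y‖ := by rw [Finset.sum_const, nsmul_eq_mul]

lemma measurable_batchGradient (S : Fin n → Z) (B : Finset (Fin n)) :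
    Measurable (batchGradient ℓ S B) := by
  have hgrad (z : Z) : Measurable (gradient fun w => ℓ w z) :=
    (InnerProductSpace.toDual ℝ (EuclideanSpace ℝ (Fin d))).symm.continuous.measurable.comp
      (measurable_fderiv ℝ fun w => ℓ w z)
  exact (Finset.measurable_fun_sum B fun i _ => hgrad (S i)).const_smul (B.card : ℝ)⁻¹

lemma batchGradient_congr {S S' : Fin n → Z} {B : Finset (Fin n)} (h : ∀ i ∈ B, S i = S' i) :
    batchGradient ℓ S B = batchGradient ℓ S' B := by
  funext w
  rw [batchGradient, batchGradient, Finset.sum_congr rfl fun i hi => by rw [h i hi]]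

lemma norm_batchGradient_sub_le {G : ℝ} (hG : ∀ w z, ‖gradient (fun u => ℓ u z) w‖ ≤ G)
    {S S' : Fin n → Z} {i : Fin n} (h : ∀ j, j ≠ i → S j = S' j) (B : Finset (Fin n))
    (w : EuclideanSpace ℝ (Fin d)) :
    ‖batchGradient ℓ S B w - batchGradient ℓ S' B w‖ ≤ (B.card : ℝ)⁻¹ * (2 * G) := by
  have hG0 : 0 ≤ G := (norm_nonneg _).trans (hG w (S i))
  rw [batchGradient, batchGradient, ← smul_sub, ← Finset.sum_sub_distrib, norm_smul, norm_inv,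
    Real.norm_natCast]
  gcongr
  by_cases hi : i ∈ B
  · rw [Finset.sum_eq_single_of_mem i hi fun j _ hj => by rw [h j hj, sub_self]]
    linarith [norm_sub_le (gradient (fun u => ℓ u (S i)) w) (gradient (fun u => ℓ u (S' i)) w),
      hG w (S i), hG w (S' i)]
  · rw [Finset.sum_eq_zero fun j hj => by rw [h j (ne_of_mem_of_not_mem hj hi), sub_self]]
    simpa using hG0

end BatchGradient

section Renyi

variable {X Y : Type*} [MeasurableSpace X] [MeasurableSpace Y] {α ε ε' : ℝ} {μ ν : Measure X}

lemma le_rpow_of_rpow_conjExponent_le_mul (hα : 1 < α) {I K : ℝ≥0∞} (hI : I ≠ ∞)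
    (h : I ^ α.conjExponent ≤ K * I) : I ≤ K ^ (α - 1) := by
  have hα1 : 0 < α - 1 := sub_pos.2 hα
  rcases eq_or_ne I 0 with rfl | hI0
  · exact zero_le
  have hexponent : α.conjExponent = (α - 1)⁻¹ + 1 := by
    rw [Real.conjExponent]; field_simp; ring
  rw [hexponent, ENNReal.rpow_add _ _ hI0 hI, ENNReal.rpow_one,
    ENNReal.mul_le_mul_iff_left hI0 hI] at h
  calc I = (I ^ (α - 1)⁻¹) ^ (α - 1) := (ENNReal.rpow_inv_rpow hα1.ne' I).symm
    _ ≤ K ^ (α - 1) := by gcongr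

/-- A dual form of `renyiDiv α μ ν ≤ ε` that mentions no density, hence composes well. -/
def RenyiDominated (α ε : ℝ) (μ ν : Measure X) : Prop :=
  ∀ f : X → ℝ≥0∞, Measurable f → (∫⁻ x, f x ∂μ) ^ α.conjExponent
    ≤ ENNReal.ofReal (Real.exp ε) * ∫⁻ x, f x ^ α.conjExponent ∂ν

namespace RenyiDominated

lemma mono (h : RenyiDominated α ε μ ν) (hε : ε ≤ ε') : RenyiDominated α ε' μ ν :=
  fun f hf => (h f hf).trans (by gcongr)

lemma map (h : RenyiDominated α ε μ ν) {g : X → Y} (hg : Measurable g) :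
    RenyiDominated α ε (μ.map g) (ν.map g) := fun f hf => by
  rw [lintegral_map hf hg, lintegral_map (hf.pow_const _) hg]
  exact h _ (hf.comp hg)

lemma bind {κ κ' : X → Measure Y} (h : RenyiDominated α ε' μ ν)
    (hκκ' : ∀ x, RenyiDominated α ε (κ x) (κ' x)) (hκ : Measurable κ) (hκ' : Measurable κ') :
    RenyiDominated α (ε' + ε) (μ.bind κ) (ν.bind κ') := fun f hf => by
  have hfr : Measurable fun y => f y ^ α.conjExponent := hf.pow_const _
  have hinner : Measurable fun x => ∫⁻ y, f y ^ α.conjExponent ∂κ' x :=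
    (Measure.measurable_lintegral hfr).comp hκ'
  rw [Measure.lintegral_bind hκ.aemeasurable hf.aemeasurable,
    Measure.lintegral_bind hκ'.aemeasurable hfr.aemeasurable, Real.exp_add,
    ENNReal.ofReal_mul (Real.exp_pos _).le, mul_assoc,
    ← lintegral_const_mul _ hinner]
  refine (h _ ((Measure.measurable_lintegral hf).comp hκ)).trans ?_
  gcongr with x
  exact hκκ' x f hf

lemma sum_smul (hα : 1 < α) {ι : Type*} [Fintype ι] {p : ι → ℝ≥0∞} (hp : ∑ i, p i = 1)
    {μ ν : ι → Measure X} (h : ∀ i, p i ≠ 0 → RenyiDominated α ε (μ i) (ν i)) :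
    RenyiDominated α ε (∑ i, p i • μ i) (∑ i, p i • ν i) := fun f hf => by
  simp only [lintegral_finsetSum_measure, lintegral_smul_measure, smul_eq_mul]
  calc (∑ i, p i * ∫⁻ x, f x ∂μ i) ^ α.conjExponent
      ≤ ∑ i, p i * (∫⁻ x, f x ∂μ i) ^ α.conjExponent :=
        ENNReal.rpow_arith_mean_le_arith_mean_rpow _ _ _ hp
          (Real.HolderConjugate.conjExponent hα).symm.lt.le
    _ ≤ ∑ i, p i * (ENNReal.ofReal (Real.exp ε) * ∫⁻ x, f x ^ α.conjExponent ∂ν i) := by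
        refine Finset.sum_le_sum fun i _ => ?_
        rcases eq_or_ne (p i) 0 with hi | hi
        · simp only [hi, zero_mul, le_refl]
        · gcongr
          exact h i hi f hf
    _ = ENNReal.ofReal (Real.exp ε) * ∑ i, p i * ∫⁻ x, f x ^ α.conjExponent ∂ν i := by
        rw [Finset.mul_sum]
        exact Finset.sum_congr rfl fun i _ => mul_left_comm _ _ _

lemma withDensity (hα : 1 < α) {ρ : X → ℝ≥0∞} (hρ : Measurable ρ)
    (hmoment : ∫⁻ x, ρ x ^ α ∂ν ≤ ENNReal.ofReal (Real.exp ((α - 1) * ε))) :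
    RenyiDominated α ε (ν.withDensity ρ) ν := fun f hf => by
  have hconj := Real.HolderConjugate.conjExponent hα
  have hα1 : 0 < α - 1 := sub_pos.2 hα
  rw [lintegral_withDensity_eq_lintegral_mul ν hρ hf]
  calc (∫⁻ x, (ρ * f) x ∂ν) ^ α.conjExponent
      ≤ ((∫⁻ x, ρ x ^ α ∂ν) ^ (1 / α)
          * (∫⁻ x, f x ^ α.conjExponent ∂ν) ^ (1 / α.conjExponent)) ^ α.conjExponent :=
        ENNReal.rpow_le_rpow (ENNReal.lintegral_mul_le_Lp_mul_Lq ν hconj hρ.aemeasurable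
          hf.aemeasurable) hconj.symm.nonneg
    _ = (∫⁻ x, ρ x ^ α ∂ν) ^ (α - 1)⁻¹ * ∫⁻ x, f x ^ α.conjExponent ∂ν := by
        rw [ENNReal.mul_rpow_of_nonneg _ _ hconj.symm.nonneg, ← ENNReal.rpow_mul,
          one_div α.conjExponent, ENNReal.rpow_inv_rpow hconj.symm.ne_zero]
        congr 2
        rw [Real.conjExponent]
        field_simp
    _ ≤ ENNReal.ofReal (Real.exp ((α - 1) * ε)) ^ (α - 1)⁻¹
          * ∫⁻ x, f x ^ α.conjExponent ∂ν := by gcongr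
    _ = ENNReal.ofReal (Real.exp ε) * ∫⁻ x, f x ^ α.conjExponent ∂ν := by
        rw [ENNReal.ofReal_rpow_of_pos (Real.exp_pos _), ← Real.exp_mul, mul_comm (α - 1),
          mul_inv_cancel_right₀ hα1.ne']

lemma refl (hα : 1 < α) (μ : Measure X) [IsProbabilityMeasure μ] : RenyiDominated α 0 μ μ := by
  simpa only [withDensity_one] using withDensity (ε := 0) hα (ρ := 1) measurable_one
    (by simp : ∫⁻ x, (1 : X → ℝ≥0∞) x ^ α ∂μ ≤ _)

lemma absolutelyContinuous (hα : 1 < α) (h : RenyiDominated α ε μ ν) : μ ≪ ν := by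
  have hr := (Real.HolderConjugate.conjExponent hα).symm.pos
  refine Measure.AbsolutelyContinuous.mk fun s hs hν => ?_
  have hindicator (x : X) :
      s.indicator (1 : X → ℝ≥0∞) x ^ α.conjExponent = s.indicator 1 x := by
    by_cases hx : x ∈ s <;> simp [hx, hr]
  have hs_le := h _ (measurable_one.indicator hs)
  simp_rw [hindicator] at hs_le
  rw [lintegral_indicator_one hs, lintegral_indicator_one hs, hν, mul_zero, nonpos_iff_eq_zero,
    ENNReal.rpow_eq_zero_iff_of_pos hr] at hs_le
  exact hs_le

/- Tested against `f = min (dμ/dν) n ^ (α - 1)`, the dual form bounds a power of the truncated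
moment by the moment itself; the truncation makes it finite, so that it can be cancelled. -/
lemma lintegral_min_rnDeriv_rpow_le [SigmaFinite μ] [IsFiniteMeasure ν] (hα : 1 < α)
    (h : RenyiDominated α ε μ ν) (n : ℕ) :
    ∫⁻ x, min (μ.rnDeriv ν x) n ^ α ∂ν ≤ ENNReal.ofReal (Real.exp ε) ^ (α - 1) := by
  have hα0 : 0 < α := one_pos.trans hα
  have hα1 : 0 < α - 1 := sub_pos.2 hα
  have hfinite : ∫⁻ x, min (μ.rnDeriv ν x) n ^ α ∂ν ≠ ∞ := by
    refine ne_top_of_le_ne_top ?_ (lintegral_mono (g := fun _ => (n : ℝ≥0∞) ^ α) fun x =>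
      ENNReal.rpow_le_rpow (min_le_right _ _) hα0.le)
    rw [lintegral_const]
    exact ENNReal.mul_ne_top (ENNReal.rpow_ne_top_of_nonneg hα0.le (ENNReal.natCast_ne_top n))
      (measure_ne_top _ _)
  have hmoment : ∫⁻ x, min (μ.rnDeriv ν x) n ^ α ∂ν
      ≤ ∫⁻ x, min (μ.rnDeriv ν x) n ^ (α - 1) ∂μ := by
    rw [← lintegral_rnDeriv_mul (h.absolutelyContinuous hα) (by fun_prop)]
    gcongr with x
    calc min (μ.rnDeriv ν x) n ^ α
        = min (μ.rnDeriv ν x) n * min (μ.rnDeriv ν x) n ^ (α - 1) := by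
          nth_rewrite 2 [← ENNReal.rpow_one (min (μ.rnDeriv ν x) n)]
          rw [← ENNReal.rpow_add_of_nonneg _ _ zero_le_one hα1.le, add_sub_cancel]
      _ ≤ μ.rnDeriv ν x * min (μ.rnDeriv ν x) n ^ (α - 1) := by
          gcongr
          exact min_le_left _ _
  have htest := h (fun x => min (μ.rnDeriv ν x) n ^ (α - 1)) (by fun_prop)
  simp_rw [← ENNReal.rpow_mul, (Real.HolderConjugate.conjExponent hα).sub_one_mul_conj] at htest
  exact le_rpow_of_rpow_conjExponent_le_mul hα hfinite
    ((ENNReal.rpow_le_rpow hmoment (Real.HolderConjugate.conjExponent hα).symm.nonneg).trans htest)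

lemma lintegral_rnDeriv_rpow_le [SigmaFinite μ] [IsFiniteMeasure ν] (hα : 1 < α)
    (h : RenyiDominated α ε μ ν) :
    ∫⁻ x, μ.rnDeriv ν x ^ α ∂ν ≤ ENNReal.ofReal (Real.exp ε) ^ (α - 1) := by
  have hlim : Filter.Tendsto (fun n : ℕ => ∫⁻ x, min (μ.rnDeriv ν x) n ^ α ∂ν) Filter.atTop
      (nhds (∫⁻ x, μ.rnDeriv ν x ^ α ∂ν)) := by
    refine lintegral_tendsto_of_tendsto_of_monotone (fun n => by fun_prop)
      (.of_forall fun x m n hmn => by dsimp only; gcongr) ?_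
    filter_upwards [μ.rnDeriv_lt_top ν] with x hx
    obtain ⟨N, hN⟩ := ENNReal.exists_nat_gt hx.ne
    refine tendsto_const_nhds.congr' ?_
    filter_upwards [Filter.eventually_ge_atTop N] with n hn
    rw [min_eq_left (hN.le.trans (by exact_mod_cast hn))]
  exact le_of_tendsto' hlim (h.lintegral_min_rnDeriv_rpow_le hα)

lemma renyiDiv_le [SigmaFinite μ] [IsFiniteMeasure ν] (hα : 1 < α)
    (h : RenyiDominated α ε μ ν) : renyiDiv α μ ν ≤ ε := by
  have hα1 : 0 < α - 1 := sub_pos.2 hα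
  have hlog := ENNReal.log_le_log (h.lintegral_rnDeriv_rpow_le hα)
  rw [ENNReal.log_rpow, ENNReal.log_ofReal_of_pos (Real.exp_pos _), Real.log_exp] at hlog
  rw [renyiDiv, if_pos (h.absolutelyContinuous hα)]
  calc (((α - 1)⁻¹ : ℝ) : EReal) * ENNReal.log (∫⁻ x, μ.rnDeriv ν x ^ α ∂ν)
      ≤ (((α - 1)⁻¹ : ℝ) : EReal) * (((α - 1 : ℝ) : EReal) * ε) :=
        mul_le_mul_of_nonneg_left hlog (by exact_mod_cast (inv_pos.2 hα1).le)
    _ = ε := by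
        rw [← EReal.coe_mul, ← EReal.coe_mul, inv_mul_cancel_left₀ hα1.ne']

end RenyiDominated

end Renyi

section GaussianShift

open scoped RealInnerProductSpace

lemma withDensity_comp_map {X Y : Type*} [MeasurableSpace X] [MeasurableSpace Y] {μ : Measure X}
    {g : X → Y} (hg : Measurable g) {ρ : Y → ℝ≥0∞} (hρ : Measurable ρ) :
    (μ.withDensity (ρ ∘ g)).map g = (μ.map g).withDensity ρ := by
  ext s hs
  rw [Measure.map_apply hg hs, withDensity_apply _ (hg hs), withDensity_apply _ hs,
    setLIntegral_map hs hρ hg]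
  rfl

lemma pi_withDensity {ι : Type*} [Fintype ι] {X : ι → Type*} [∀ i, MeasurableSpace (X i)]
    {μ : ∀ i, Measure (X i)} [∀ i, IsProbabilityMeasure (μ i)] {ρ : ∀ i, X i → ℝ≥0∞}
    (hρ : ∀ i, Measurable (ρ i)) [∀ i, SigmaFinite ((μ i).withDensity (ρ i))] :
    Measure.pi (fun i => (μ i).withDensity (ρ i))
      = (Measure.pi μ).withDensity fun x => ∏ i, ρ i (x i) := by
  refine Measure.pi_eq fun s hs => ?_
  have hm (i : ι) : Measurable ((s i).indicator (ρ i)) := (hρ i).indicator (hs i)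
  have hindicator (x : ∀ i, X i) : (Set.univ.pi s).indicator (fun x => ∏ i, ρ i (x i)) x
      = ∏ i, (s i).indicator (ρ i) (x i) := by
    by_cases hx : x ∈ Set.univ.pi s
    · rw [Set.indicator_of_mem hx]
      exact Finset.prod_congr rfl fun i _ => by
        rw [Set.indicator_of_mem (hx i (Set.mem_univ i))]
    · obtain ⟨i, hi⟩ : ∃ i, x i ∉ s i := by simpa [Set.mem_pi] using hx
      rw [Set.indicator_of_notMem hx,
        Finset.prod_eq_zero (Finset.mem_univ i) (Set.indicator_of_notMem hi _)]
  rw [withDensity_apply _ (MeasurableSet.univ_pi hs),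
    ← lintegral_indicator (MeasurableSet.univ_pi hs), lintegral_congr hindicator,
    lintegral_prod_eq_prod_lintegral_of_indepFun _ _
      (iIndepFun_pi fun i => (hm i).aemeasurable) fun i => (hm i).comp (measurable_pi_apply i)]
  refine Finset.prod_congr rfl fun i _ => ?_
  rw [(measurePreserving_eval μ i).lintegral_comp (hm i), lintegral_indicator (hs i),
    withDensity_apply _ (hs i)]

lemma gaussianReal_one_eq_withDensity (a : ℝ) :
    gaussianReal a 1 = (gaussianReal 0 1).withDensity
      fun x => ENNReal.ofReal (Real.exp (a * x - a ^ 2 / 2)) := by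
  rw [gaussianReal_of_var_ne_zero _ one_ne_zero, gaussianReal_of_var_ne_zero _ one_ne_zero,
    ← withDensity_mul _ (measurable_gaussianPDF _ _) (by fun_prop)]
  congr 1 with x
  simp only [Pi.mul_apply, gaussianPDF, gaussianPDFReal, NNReal.coe_one]
  rw [← ENNReal.ofReal_mul (by positivity), mul_assoc (√_)⁻¹, ← Real.exp_add]
  congr 3
  ring

lemma map_add_pi_gaussianReal {ι : Type*} [Fintype ι] (a : ι → ℝ) :
    (Measure.pi fun _ : ι => gaussianReal 0 1).map (a + ·)
      = (Measure.pi fun _ : ι => gaussianReal 0 1).withDensity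
        fun x => ∏ i, ENNReal.ofReal (Real.exp (a i * x i - a i ^ 2 / 2)) := by
  have hsigma (i : ι) : SigmaFinite ((gaussianReal 0 1).withDensity
      fun x => ENNReal.ofReal (Real.exp (a i * x - a i ^ 2 / 2))) := by
    rw [← gaussianReal_one_eq_withDensity]; infer_instance
  rw [← pi_withDensity (ρ := fun i x => ENNReal.ofReal (Real.exp (a i * x - a i ^ 2 / 2)))
    fun i => by fun_prop]
  simp_rw [← gaussianReal_one_eq_withDensity]
  refine (Measure.pi_map_pi (f := fun i x => a i + x) fun i => by fun_prop).trans ?_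
  simp only [gaussianReal_map_const_add, zero_add]

variable {E : Type*} [NormedAddCommGroup E] [InnerProductSpace ℝ E]

/-- The Cameron–Martin density, with respect to the standard Gaussian measure, of its translate
by `h`. -/
noncomputable def cameronMartinDensity (h x : E) : ℝ≥0∞ :=
  ENNReal.ofReal (Real.exp (⟪h, x⟫ - ‖h‖ ^ 2 / 2))

lemma cameronMartinDensity_rpow (α : ℝ) (h x : E) : cameronMartinDensity h x ^ α
    = ENNReal.ofReal (Real.exp ((α - 1) * (α * ‖h‖ ^ 2 / 2))) * cameronMartinDensity (α • h) x := by
  rw [cameronMartinDensity, cameronMartinDensity, ENNReal.ofReal_rpow_of_pos (Real.exp_pos _),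
    ← Real.exp_mul, ← ENNReal.ofReal_mul (Real.exp_pos _).le, ← Real.exp_add,
    real_inner_smul_left, norm_smul, mul_pow, Real.norm_eq_abs, sq_abs]
  congr 2
  ring

variable [MeasurableSpace E] [BorelSpace E] [FiniteDimensional ℝ E]

lemma measurable_cameronMartinDensity (h : E) : Measurable (cameronMartinDensity h) := by
  unfold cameronMartinDensity
  fun_prop

lemma map_add_stdGaussian (h : E) :
    (stdGaussian E).map (h + ·) = (stdGaussian E).withDensity (cameronMartinDensity h) := by
  let b := stdOrthonormalBasis ℝ E
  let Φ : (Fin (Module.finrank ℝ E) → ℝ) → E := fun x => ∑ i, x i • b i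
  have hΦ : Measurable Φ := by fun_prop
  have hshift : (h + ·) ∘ Φ = Φ ∘ ((fun i => ⟪b i, h⟫) + ·) := by
    funext x
    simp only [Φ, Function.comp_apply, Pi.add_apply, add_smul, Finset.sum_add_distrib, b.sum_repr']
  have hdensity : (fun x : Fin (Module.finrank ℝ E) → ℝ =>
      ∏ i, ENNReal.ofReal (Real.exp (⟪b i, h⟫ * x i - ⟪b i, h⟫ ^ 2 / 2)))
      = cameronMartinDensity h ∘ Φ := by
    funext x
    have hinner : ⟪h, Φ x⟫ = ∑ i, ⟪b i, h⟫ * x i := by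
      simp only [Φ, inner_sum, real_inner_smul_right, real_inner_comm h, mul_comm (x _)]
    have hnorm : ‖h‖ ^ 2 = ∑ i, ⟪b i, h⟫ ^ 2 := by
      simpa using (b.sum_sq_norm_inner_right h).symm
    rw [Function.comp_apply, cameronMartinDensity, hinner, hnorm, Finset.sum_div,
      ← Finset.sum_sub_distrib, Real.exp_sum,
      ENNReal.ofReal_prod_of_nonneg fun i _ => (Real.exp_pos _).le]
  rw [stdGaussian_eq_map_pi_orthonormalBasis b, Measure.map_map (by fun_prop) hΦ]
  change Measure.map ((h + ·) ∘ Φ) _ = (Measure.map Φ _).withDensity _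
  rw [hshift, ← Measure.map_map hΦ (by fun_prop), map_add_pi_gaussianReal, hdensity,
    withDensity_comp_map hΦ (measurable_cameronMartinDensity h)]

lemma lintegral_cameronMartinDensity (h : E) :
    ∫⁻ x, cameronMartinDensity h x ∂stdGaussian E = 1 := by
  rw [← setLIntegral_univ, ← withDensity_apply _ MeasurableSet.univ, ← map_add_stdGaussian,
    Measure.map_apply (by fun_prop) MeasurableSet.univ, Set.preimage_univ, measure_univ]

lemma renyiDominated_map_add_stdGaussian {α : ℝ} (hα : 1 < α) (h : E) :
    RenyiDominated α (α * ‖h‖ ^ 2 / 2) ((stdGaussian E).map (h + ·)) (stdGaussian E) := by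
  rw [map_add_stdGaussian]
  refine RenyiDominated.withDensity hα (measurable_cameronMartinDensity h) (le_of_eq ?_)
  simp_rw [cameronMartinDensity_rpow]
  rw [lintegral_const_mul _ (measurable_cameronMartinDensity _), lintegral_cameronMartinDensity,
    mul_one]

end GaussianShift

section Gaussian

variable {d : ℕ} {α v : ℝ}

instance isProbabilityMeasure_gaussian (m : EuclideanSpace ℝ (Fin d)) (v : ℝ) :
    IsProbabilityMeasure (gaussian m v) := by
  unfold gaussian; infer_instance

lemma map_add_gaussian (a m : EuclideanSpace ℝ (Fin d)) (v : ℝ) :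
    (gaussian m v).map (a + ·) = gaussian (a + m) v := by
  rw [gaussian, gaussian, multivariateGaussian, multivariateGaussian,
    Measure.map_map (by fun_prop) (by fun_prop)]
  simp only [Function.comp_def, add_assoc]

lemma measurable_gaussian {X : Type*} [MeasurableSpace X] {m : X → EuclideanSpace ℝ (Fin d)}
    (hm : Measurable m) (v : ℝ) : Measurable fun x => gaussian (m x) v := by
  have hprod (x : X) : gaussian (m x) v
      = ((gaussian 0 v).map (Prod.mk (m x))).map fun p => p.1 + p.2 := by
    rw [Measure.map_map (by fun_prop) (by fun_prop)]
    simpa only [add_zero, Function.comp_def] using (map_add_gaussian (m x) 0 v).symm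
  simp_rw [hprod]
  exact (Measure.measurable_map _ (by fun_prop)).comp (Measurable.map_prodMk_left.comp hm)

open scoped MatrixOrder in
lemma gaussian_eq_map_stdGaussian (m : EuclideanSpace ℝ (Fin d)) (hv : 0 ≤ v) :
    gaussian m v = (stdGaussian (EuclideanSpace ℝ (Fin d))).map fun x => m + √v • x := by
  have hsqrt : CFC.sqrt (v • (1 : Matrix (Fin d) (Fin d) ℝ)) = √v • 1 := by
    refine CFC.sqrt_unique ?_ (smul_nonneg (Real.sqrt_nonneg v) zero_le_one)
    rw [smul_mul_smul_comm, Real.mul_self_sqrt hv, one_mul]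
  rw [gaussian, multivariateGaussian, hsqrt]
  simp only [map_smul, map_one, smul_apply, one_apply_eq_self]

lemma renyiDominated_gaussian (hα : 1 < α) (hv : 0 < v) (p q : EuclideanSpace ℝ (Fin d)) :
    RenyiDominated α (α * ‖p - q‖ ^ 2 / (2 * v)) (gaussian p v) (gaussian q v) := by
  have hsqrt : √v ≠ 0 := (Real.sqrt_pos.2 hv).ne'
  have hshift : (fun x : EuclideanSpace ℝ (Fin d) => q + √v • x) ∘ ((√v)⁻¹ • (p - q) + ·)
      = fun x => p + √v • x := by
    funext x
    rw [Function.comp_apply, smul_add, smul_inv_smul₀ hsqrt]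
    abel
  have hstd := (renyiDominated_map_add_stdGaussian hα ((√v)⁻¹ • (p - q))).map
    (g := fun x => q + √v • x) (by fun_prop)
  rw [Measure.map_map (by fun_prop) (by fun_prop), hshift, ← gaussian_eq_map_stdGaussian p hv.le,
    ← gaussian_eq_map_stdGaussian q hv.le] at hstd
  refine hstd.mono (le_of_eq ?_)
  rw [norm_smul, mul_pow, norm_inv, Real.norm_of_nonneg (Real.sqrt_nonneg v), inv_pow,
    Real.sq_sqrt hv.le]
  field_simp

lemma gaussian_bind_eq_gaussian_add_bind {X : Type*} [MeasurableSpace X]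
    {κ : EuclideanSpace ℝ (Fin d) → Measure X} (hκ : Measurable κ)
    (p b : EuclideanSpace ℝ (Fin d)) (v : ℝ) :
    (gaussian p v).bind κ = (gaussian (b + p) v).bind fun x => κ (x - b) := by
  refine Measure.ext_of_lintegral _ fun f hf => ?_
  have hκf : Measurable fun x => ∫⁻ y, f y ∂κ x := (Measure.measurable_lintegral hf).comp hκ
  have hκb : Measurable fun x => κ (x - b) := hκ.comp (measurable_id.sub_const b)
  rw [Measure.lintegral_bind hκ.aemeasurable hf.aemeasurable,
    Measure.lintegral_bind hκb.aemeasurable hf.aemeasurable, ← map_add_gaussian,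
    lintegral_map (f := fun x => ∫⁻ y, f y ∂κ (x - b)) (hκf.comp (measurable_id.sub_const b))
      (by fun_prop)]
  simp only [add_sub_cancel_left]

end Gaussian

section PowerHarnack

variable {d : ℕ} {X : Type*} [MeasurableSpace X] {α : ℝ}

/-- Wang's power Harnack inequality for the kernel `κ`, with the constant of a Gaussian kernel of
variance `V`. For `V = 0`, where the cost `‖x - y‖ ^ 2 / (2 * V)` of distinct points should be
infinite, it is only required on the diagonal. -/
def PowerHarnack {E : Type*} [NormedAddCommGroup E] (α V : ℝ) (κ : E → Measure X) : Prop :=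
  ∀ x y, (V = 0 → x = y) → RenyiDominated α (α * ‖x - y‖ ^ 2 / (2 * V)) (κ x) (κ y)

lemma powerHarnack_dirac {E : Type*} [NormedAddCommGroup E] [MeasurableSpace E] (hα : 1 < α) :
    PowerHarnack α 0 (Measure.dirac : E → Measure E) := by
  intro x y hxy
  obtain rfl := hxy rfl
  simpa using RenyiDominated.refl hα (Measure.dirac x)

/- The distance between the means is split between the Gaussian and the kernel in proportion to
their variances: the Gaussian only pays for the shift from `p + b` to `q`, and the kernel for the
shift by `b`. -/
lemma PowerHarnack.renyiDominated_gaussian_bind {V v : ℝ} (hα : 1 < α) (hV : 0 ≤ V) (hv : 0 < v)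
    {κ : EuclideanSpace ℝ (Fin d) → Measure X} (hκ : Measurable κ) (h : PowerHarnack α V κ)
    (p q : EuclideanSpace ℝ (Fin d)) :
    RenyiDominated α (α * ‖p - q‖ ^ 2 / (2 * (V + v)))
      ((gaussian p v).bind κ) ((gaussian q v).bind κ) := by
  have hVv : 0 < V + v := by linarith
  let b := (V / (V + v)) • (q - p)
  have hkernel (x : EuclideanSpace ℝ (Fin d)) :
      RenyiDominated α (α * ‖b‖ ^ 2 / (2 * V)) (κ (x - b)) (κ x) := by
    have hxb := h (x - b) x fun hV0 => by simp [b, hV0]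
    rwa [sub_sub_cancel_left, norm_neg] at hxb
  have hsplit := (renyiDominated_gaussian hα hv (b + p) q).bind hkernel
    (hκ.comp (measurable_id.sub_const b)) hκ
  rw [gaussian_bind_eq_gaussian_add_bind hκ p b]
  refine hsplit.mono (le_of_eq ?_)
  have hshift : b + p - q = (v / (V + v)) • (p - q) := by
    have hv_ratio : v / (V + v) = 1 - V / (V + v) := by field_simp; ring
    simp only [b, hv_ratio]
    module
  rw [hshift, norm_smul, norm_smul, norm_sub_rev q p, mul_pow, mul_pow, Real.norm_eq_abs,
    Real.norm_eq_abs, sq_abs, sq_abs]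
  rcases hV.eq_or_lt with rfl | hV
  · field_simp
    simp only [add_zero, zero_add, mul_comm]
  · field_simp
    ring

end PowerHarnack

section Dynamics

variable {d n : ℕ} {Z : Type*} {ℓ : EuclideanSpace ℝ (Fin d) → Z → ℝ} {S S' : Fin n → Z}
  {α β₀ : ℝ} {η lam : ℕ → ℝ} {M : ℕ → Finset (Fin n)}

lemma measurable_stepLaw (ℓ : EuclideanSpace ℝ (Fin d) → Z → ℝ) (S : Fin n → Z)
    (β₀ η lam : ℝ) (B : Finset (Fin n)) : Measurable (stepLaw ℓ S β₀ η lam B) := by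
  have hgradient := measurable_batchGradient (ℓ := ℓ) S B
  have hmean : Measurable fun w => (1 - lam * η) • (w - η • batchGradient ℓ S B w) := by fun_prop
  exact measurable_gaussian hmean _

lemma stepLaw_congr {B : Finset (Fin n)} (h : ∀ i ∈ B, S i = S' i) (β₀ η lam : ℝ) :
    stepLaw ℓ S β₀ η lam B = stepLaw ℓ S' β₀ η lam B := by
  funext w
  rw [stepLaw, stepLaw, batchGradient_congr h]

instance isProbabilityMeasure_iterateLaw (k : ℕ) :
    IsProbabilityMeasure (iterateLaw ℓ S β₀ η lam M k) := by
  induction k with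
  | zero => exact isProbabilityMeasure_gaussian 0 β₀
  | succ k ih =>
    exact isProbabilityMeasure_bind (measurable_stepLaw ℓ S _ _ _ _).aemeasurable
      (.of_forall fun w => isProbabilityMeasure_gaussian _ _)

lemma iterateLaw_congr {k : ℕ} (h : ∀ t ∈ Set.Ioc 1 (k + 1), ∀ i ∈ M t, S i = S' i) :
    iterateLaw ℓ S β₀ η lam M k = iterateLaw ℓ S' β₀ η lam M k := by
  induction k with
  | zero => rfl
  | succ k ih =>
    rw [iterateLaw, iterateLaw, ih fun t ht => h t ⟨ht.1, ht.2.trans (Nat.le_succ _)⟩,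
      stepLaw_congr (h (k + 2) ⟨by omega, le_rfl⟩)]

/-- The conditional law of `w_{k+1+m}` given `w_{k+1}`. -/
noncomputable def remainingLaw (ℓ : EuclideanSpace ℝ (Fin d) → Z → ℝ) (S : Fin n → Z) (β₀ : ℝ)
    (η lam : ℕ → ℝ) (M : ℕ → Finset (Fin n)) :
    ℕ → ℕ → EuclideanSpace ℝ (Fin d) → Measure (EuclideanSpace ℝ (Fin d))
  | _, 0 => Measure.dirac
  | k, m + 1 => fun w => (stepLaw ℓ S β₀ (η (k + 2)) (lam (k + 2)) (M (k + 2)) w).bind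
      (remainingLaw ℓ S β₀ η lam M (k + 1) m)

lemma measurable_remainingLaw (k m : ℕ) : Measurable (remainingLaw ℓ S β₀ η lam M k m) := by
  induction m generalizing k with
  | zero => exact Measure.measurable_dirac
  | succ m ih =>
    exact (Measure.measurable_bind' (ih (k + 1))).comp (measurable_stepLaw ℓ S _ _ _ _)

lemma remainingLaw_congr {k m : ℕ}
    (h : ∀ t ∈ Set.Ioc (k + 1) (k + 1 + m), ∀ i ∈ M t, S i = S' i) :
    remainingLaw ℓ S β₀ η lam M k m = remainingLaw ℓ S' β₀ η lam M k m := by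
  induction m generalizing k with
  | zero => rfl
  | succ m ih =>
    funext w
    rw [remainingLaw, remainingLaw, stepLaw_congr (h (k + 2) ⟨by omega, by omega⟩),
      ih fun t ht => h t ⟨by grind, by grind⟩]

lemma iterateLaw_add (k m : ℕ) : iterateLaw ℓ S β₀ η lam M (k + m)
    = (iterateLaw ℓ S β₀ η lam M k).bind (remainingLaw ℓ S β₀ η lam M k m) := by
  induction m generalizing k with
  | zero => exact Measure.bind_dirac.symm
  | succ m ih =>
    rw [← Nat.succ_add_eq_add_succ, ih (k + 1), iterateLaw,
      Measure.bind_bind (measurable_stepLaw ℓ S _ _ _ _).aemeasurable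
        (measurable_remainingLaw _ _).aemeasurable]
    rfl

/-- The product of the contraction factors `1 - λ_t η_t` of the iterations from `w_{k+1}` to
`w_{k+1+m}`. -/
noncomputable def contraction (η lam : ℕ → ℝ) : ℕ → ℕ → ℝ
  | _, 0 => 1
  | k, m + 1 => (1 - lam (k + 2) * η (k + 2)) * contraction η lam (k + 1) m

lemma contraction_mem_Ioc (hdecay : ∀ t ≥ 2, lam t * η t ∈ Set.Ioo 0 1) (k m : ℕ) :
    contraction η lam k m ∈ Set.Ioc 0 1 := by
  induction m generalizing k with
  | zero => exact ⟨one_pos, le_rfl⟩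
  | succ m ih =>
    obtain ⟨hpos, hlt⟩ := hdecay (k + 2) (by omega)
    exact ⟨mul_pos (sub_pos.2 hlt) (ih (k + 1)).1,
      mul_le_one₀ (sub_le_self 1 hpos.le) (ih (k + 1)).1.le (ih (k + 1)).2⟩

/-- The variance that the noise of the iterations with total contraction factor `Γ` would have if
it were all injected before the first of them: its variance at the end is `(1 - Γ ^ 2) * β₀`,
because `N(0, β₀ I)` is stationary for the iteration without gradients. -/
noncomputable def harnackVariance (β₀ Γ : ℝ) : ℝ := β₀ * ((Γ ^ 2)⁻¹ - 1)

lemma harnackVariance_nonneg (hβ₀ : 0 ≤ β₀) {Γ : ℝ} (hΓ : Γ ∈ Set.Ioc 0 1) :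
    0 ≤ harnackVariance β₀ Γ :=
  mul_nonneg hβ₀ (sub_nonneg.2 ((one_le_inv₀ (pow_pos hΓ.1 2)).2 (pow_le_one₀ hΓ.1.le hΓ.2)))

lemma harnackVariance_add (β₀ : ℝ) {lam η : ℝ} (h : lam * η ≠ 1) (Γ : ℝ) :
    harnackVariance β₀ Γ + lam * η * (2 - lam * η) * β₀
      = (1 - lam * η) ^ 2 * harnackVariance β₀ ((1 - lam * η) * Γ) := by
  have hcancel : (1 - lam * η) ^ 2 * ((1 - lam * η) ^ 2)⁻¹ = 1 :=
    mul_inv_cancel₀ (pow_ne_zero 2 (sub_ne_zero.2 h.symm))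
  rw [harnackVariance, harnackVariance, mul_pow, mul_inv]
  linear_combination (-β₀ * (Γ ^ 2)⁻¹) * hcancel

lemma renyiDominated_stepLaw_bind (hα : 1 < α) (hβ₀ : 0 < β₀) {Γ : ℝ} (hΓ : Γ ∈ Set.Ioc 0 1)
    {η lam : ℝ} (hdecay : lam * η ∈ Set.Ioo 0 1) {X : Type*} [MeasurableSpace X]
    {κ : EuclideanSpace ℝ (Fin d) → Measure X} (hκ : Measurable κ)
    (h : PowerHarnack α (harnackVariance β₀ Γ) κ) (B : Finset (Fin n))
    (w w' : EuclideanSpace ℝ (Fin d)) :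
    RenyiDominated α
      (α * ‖(w - η • batchGradient ℓ S B w) - (w' - η • batchGradient ℓ S' B w')‖ ^ 2
        / (2 * harnackVariance β₀ ((1 - lam * η) * Γ)))
      ((stepLaw ℓ S β₀ η lam B w).bind κ) ((stepLaw ℓ S' β₀ η lam B w').bind κ) := by
  have hvariance : 0 < lam * η * (2 - lam * η) * β₀ :=
    mul_pos (mul_pos hdecay.1 (by linarith [hdecay.2])) hβ₀
  refine (h.renyiDominated_gaussian_bind hα (harnackVariance_nonneg hβ₀.le hΓ) hvariance hκ
    _ _).mono (le_of_eq ?_)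
  rw [harnackVariance_add β₀ hdecay.2.ne, ← smul_sub, norm_smul, mul_pow, Real.norm_eq_abs, sq_abs,
    mul_left_comm α, mul_left_comm 2,
    mul_div_mul_left _ _ (pow_ne_zero 2 (sub_pos.2 hdecay.2).ne')]

lemma powerHarnack_remainingLaw (hα : 1 < α) (hβ₀ : 0 < β₀)
    (hdecay : ∀ t ≥ 2, lam t * η t ∈ Set.Ioo 0 1)
    (hstep : ∀ t ≥ 2, LipschitzWith 1 fun w => w - η t • batchGradient ℓ S (M t) w) (k m : ℕ) :
    PowerHarnack α (harnackVariance β₀ (contraction η lam k m))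
      (remainingLaw ℓ S β₀ η lam M k m) := by
  induction m generalizing k with
  | zero =>
    simpa only [contraction, remainingLaw, harnackVariance, one_pow, inv_one, sub_self, mul_zero]
      using powerHarnack_dirac hα
  | succ m ih =>
    intro x y _
    refine (renyiDominated_stepLaw_bind hα hβ₀ (contraction_mem_Ioc hdecay (k + 1) m)
      (hdecay (k + 2) (by omega)) (measurable_remainingLaw (k + 1) m) (ih (k + 1)) (M (k + 2))
      x y).mono ?_
    have hnonneg := harnackVariance_nonneg hβ₀.le (contraction_mem_Ioc hdecay k (m + 1))
    have hcontract : ‖(x - η (k + 2) • batchGradient ℓ S (M (k + 2)) x)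
        - (y - η (k + 2) • batchGradient ℓ S (M (k + 2)) y)‖ ≤ ‖x - y‖ := by
      simpa [dist_eq_norm] using (hstep (k + 2) (by omega)).dist_le_mul x y
    rw [contraction] at hnonneg ⊢
    gcongr

lemma renyiDominated_iterateLaw (hα : 1 < α) (hβ₀ : 0 < β₀)
    (hdecay : ∀ t ≥ 2, lam t * η t ∈ Set.Ioo 0 1)
    (hstep : ∀ t ≥ 2, LipschitzWith 1 fun w => w - η t • batchGradient ℓ S' (M t) w)
    {k m : ℕ} (hagree : ∀ t ∈ Set.Ioc 1 (k + 2 + m), t ≠ k + 2 → ∀ i ∈ M t, S i = S' i) {Δ : ℝ}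
    (hΔ : ∀ w, ‖η (k + 2) • (batchGradient ℓ S (M (k + 2)) w
      - batchGradient ℓ S' (M (k + 2)) w)‖ ≤ Δ) :
    RenyiDominated α (α * Δ ^ 2 / (2 * harnackVariance β₀ (contraction η lam k (m + 1))))
      (iterateLaw ℓ S β₀ η lam M (k + (m + 1))) (iterateLaw ℓ S' β₀ η lam M (k + (m + 1))) := by
  have hbefore : iterateLaw ℓ S β₀ η lam M k = iterateLaw ℓ S' β₀ η lam M k :=
    iterateLaw_congr fun t ht => hagree t ⟨ht.1, by grind⟩ (by grind)
  have hafter : remainingLaw ℓ S β₀ η lam M (k + 1) m = remainingLaw ℓ S' β₀ η lam M (k + 1) m :=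
    remainingLaw_congr fun t ht => hagree t ⟨by grind, ht.2⟩ (by grind)
  rw [iterateLaw_add, iterateLaw_add, hbefore, ← zero_add (α * Δ ^ 2 / _)]
  refine (RenyiDominated.refl hα _).bind (fun w => ?_) (measurable_remainingLaw _ _)
    (measurable_remainingLaw _ _)
  rw [remainingLaw, remainingLaw, hafter]
  refine (renyiDominated_stepLaw_bind hα hβ₀ (contraction_mem_Ioc hdecay (k + 1) m)
    (hdecay (k + 2) (by omega)) (measurable_remainingLaw (k + 1) m)
    (powerHarnack_remainingLaw hα hβ₀ hdecay hstep (k + 1) m) (M (k + 2)) w w).mono ?_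
  have hnonneg := harnackVariance_nonneg hβ₀.le (contraction_mem_Ioc hdecay k (m + 1))
  rw [contraction] at hnonneg ⊢
  gcongr
  rw [sub_sub_sub_cancel_left, ← smul_sub, norm_smul, norm_sub_rev, ← norm_smul]
  exact hΔ w

end Dynamics

section SinglePass

variable {d n T : ℕ} {Z : Type*} {ℓ : EuclideanSpace ℝ (Fin d) → Z → ℝ} {S S' : Fin n → Z}
  {α β₀ η G : ℝ}

lemma contraction_one_div_mul (hη : η ≠ 0) (k m : ℕ) :
    contraction (fun _ => η) (fun t => 1 / ((t : ℝ) * η)) k m = ((k : ℝ) + 1) / (k + 1 + m) := by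
  induction m generalizing k with
  | zero =>
    rw [contraction, Nat.cast_zero, add_zero, div_self (Nat.cast_add_one_ne_zero k)]
  | succ m ih =>
    rw [contraction, ih (k + 1)]
    push_cast
    have : (k : ℝ) + 1 + 1 + m ≠ 0 := by positivity
    field_simp
    ring

lemma one_div_mul_mul_mem_Ioo (hη : η ≠ 0) {t : ℕ} (ht : 2 ≤ t) :
    1 / ((t : ℝ) * η) * η ∈ Set.Ioo 0 1 := by
  have ht' : (1 : ℝ) < t := by exact_mod_cast ht
  have hcancel : 1 / ((t : ℝ) * η) * η = (t : ℝ)⁻¹ := by field_simp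
  rw [hcancel]
  exact ⟨by positivity, inv_lt_one_of_one_lt₀ ht'⟩

lemma one_le_sq_mul_inv_sq_sub_one {s τ b : ℝ} (hs : 0 < s) (hτ : s < τ)
    (hb : τ / (2 * (τ - s)) ≤ b ^ 2) : 1 ≤ b ^ 2 * (((s / τ) ^ 2)⁻¹ - 1) := by
  have hτs : 0 < τ - s := sub_pos.2 hτ
  have hfactor : ((s / τ) ^ 2)⁻¹ - 1 = (τ - s) * (τ + s) / s ^ 2 := by
    have := (hs.trans hτ).ne'
    field_simp
    ring
  rw [hfactor]
  calc 1 ≤ τ * (τ + s) / (2 * s ^ 2) := by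
        rw [one_le_div (by positivity)]
        nlinarith
    _ = τ / (2 * (τ - s)) * ((τ - s) * (τ + s) / s ^ 2) := by field_simp
    _ ≤ b ^ 2 * ((τ - s) * (τ + s) / s ^ 2) :=
        mul_le_mul_of_nonneg_right hb (by have := hs.trans hτ; positivity)

lemma sq_div_harnackVariance_le (hα : 0 ≤ α) (hβ₀ : 0 < β₀) {s τ b : ℝ} (hs : 0 < s) (hτ : s < τ)
    (hb : τ / (2 * (τ - s)) ≤ b ^ 2) (η G : ℝ) :
    α * (η * (b⁻¹ * (2 * G))) ^ 2 / (2 * harnackVariance β₀ (s / τ))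
      ≤ 2 * α * η ^ 2 * G ^ 2 / β₀ := by
  have hle := one_le_sq_mul_inv_sq_sub_one hs hτ hb
  calc α * (η * (b⁻¹ * (2 * G))) ^ 2 / (2 * harnackVariance β₀ (s / τ))
      = 2 * α * η ^ 2 * G ^ 2 / β₀ * (b ^ 2 * (((s / τ) ^ 2)⁻¹ - 1))⁻¹ := by
        rw [harnackVariance]
        generalize ((s / τ) ^ 2)⁻¹ - 1 = c
        ring
    _ ≤ 2 * α * η ^ 2 * G ^ 2 / β₀ :=
        mul_le_of_le_one_right (by positivity) (inv_le_one_of_one_le₀ hle)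

lemma Schedule.IsSinglePass.disjoint_batch {M : Schedule T n} (hM : M.IsSinglePass) {s t : ℕ}
    (hst : s ≠ t) : Disjoint (M.batch s) (M.batch t) := by
  unfold Schedule.batch
  split_ifs
  · exact hM.1 _ _ (Subtype.coe_ne_coe.1 hst)
  all_goals simp

lemma Schedule.IsSinglePass.le_sq_card_batch {M : Schedule T n} (hM : M.IsSinglePass) {t : ℕ}
    (ht : t ∈ Finset.Icc 2 T) :
    (T : ℝ) / (2 * ((T : ℝ) - t + 1)) ≤ ((M.batch t).card : ℝ) ^ 2 := by
  rw [Schedule.batch, dif_pos ht, hM.2 ⟨t, ht⟩]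
  exact (Real.sqrt_le_left (Nat.cast_nonneg _)).1 (Nat.le_ceil _)

lemma Neighboring.eq_of_ne {i : Fin n} (h : Neighboring S S') (hi : S i ≠ S' i) {j : Fin n}
    (hj : j ≠ i) : S j = S' j := by
  by_contra hne
  exact hj ((Set.ncard_le_one_iff (Set.toFinite _)).1 h hne hi)

lemma Schedule.IsSinglePass.renyiDominated_iterateLaw_of_mem_batch (hα : 1 < α) (hβ₀ : 0 < β₀)
    (hη : 0 < η) (hstep : ∀ z, LipschitzWith 1 fun w => w - η • gradient (fun u => ℓ u z) w)
    (hG : ∀ w z, ‖gradient (fun u => ℓ u z) w‖ ≤ G) {M : Schedule T n} (hM : M.IsSinglePass)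
    {i : Fin n} (hSS' : ∀ j, j ≠ i → S j = S' j) {t : ℕ} (ht : t ∈ Finset.Icc 2 T)
    (hi : i ∈ M.batch t) :
    RenyiDominated α (2 * α * η ^ 2 * G ^ 2 / β₀)
      (iterateLaw ℓ S β₀ (fun _ => η) (fun t => 1 / ((t : ℝ) * η)) M.batch (T - 1))
      (iterateLaw ℓ S' β₀ (fun _ => η) (fun t => 1 / ((t : ℝ) * η)) M.batch (T - 1)) := by
  have hcard := hM.le_sq_card_batch ht
  obtain ⟨k, rfl⟩ : ∃ k, t = k + 2 := Nat.exists_eq_add_of_le' (Finset.mem_Icc.1 ht).1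
  obtain ⟨m, rfl⟩ : ∃ m, T = k + 2 + m := Nat.exists_eq_add_of_le (Finset.mem_Icc.1 ht).2
  have hlast : k + 2 + m - 1 = k + (m + 1) := by omega
  have hagree : ∀ t ∈ Set.Ioc 1 (k + 2 + m), t ≠ k + 2 → ∀ j ∈ M.batch t, S j = S' j := by
    rintro t - hne j hj
    refine hSS' j ?_
    rintro rfl
    exact Finset.disjoint_left.1 (hM.disjoint_batch hne) hj hi
  have hshift : ∀ w, ‖η • (batchGradient ℓ S (M.batch (k + 2)) w
      - batchGradient ℓ S' (M.batch (k + 2)) w)‖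
      ≤ η * (((M.batch (k + 2)).card : ℝ)⁻¹ * (2 * G)) := by
    intro w
    rw [norm_smul, Real.norm_of_nonneg hη.le]
    exact mul_le_mul_of_nonneg_left (norm_batchGradient_sub_le hG hSS' _ w) hη.le
  rw [hlast]
  refine (renyiDominated_iterateLaw hα hβ₀ (fun t ht => one_div_mul_mul_mem_Ioo hη.ne' ht)
    (fun t _ => lipschitzWith_one_sub_smul_batchGradient hstep S' (M.batch t)) hagree
    hshift).mono ?_
  rw [contraction_one_div_mul hη.ne']
  refine sq_div_harnackVariance_le (by positivity) hβ₀ (by positivity) ?_ ?_ η G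
  · push_cast
    linarith [(Nat.cast_nonneg m : (0 : ℝ) ≤ m)]
  · convert hcard using 2 <;> push_cast <;> ring

lemma Schedule.IsSinglePass.renyiDominated_iterateLaw (hα : 1 < α) (hβ₀ : 0 < β₀) (hη : 0 < η)
    (hstep : ∀ z, LipschitzWith 1 fun w => w - η • gradient (fun u => ℓ u z) w)
    (hG : ∀ w z, ‖gradient (fun u => ℓ u z) w‖ ≤ G) {M : Schedule T n} (hM : M.IsSinglePass)
    (hSS' : Neighboring S S') :
    RenyiDominated α (2 * α * η ^ 2 * G ^ 2 / β₀)
      (iterateLaw ℓ S β₀ (fun _ => η) (fun t => 1 / ((t : ℝ) * η)) M.batch (T - 1))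
      (iterateLaw ℓ S' β₀ (fun _ => η) (fun t => 1 / ((t : ℝ) * η)) M.batch (T - 1)) := by
  by_cases hused : ∃ t ∈ Finset.Icc 2 T, ∃ i ∈ M.batch t, S i ≠ S' i
  · obtain ⟨t, ht, i, hit, hi⟩ := hused
    exact hM.renyiDominated_iterateLaw_of_mem_batch hα hβ₀ hη hstep hG
      (fun j hj => hSS'.eq_of_ne hi hj) ht hit
  · push Not at hused
    rw [iterateLaw_congr (S' := S') fun t ht =>
      hused t (Finset.mem_Icc.2 ⟨ht.1, by grind⟩)]
    exact (RenyiDominated.refl hα _).mono (by positivity)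

lemma sum_pmf_eq_one {ι : Type*} [Fintype ι] (p : PMF ι) : ∑ i, p i = 1 := by
  rw [← tsum_fintype (L := .unconditional _), p.tsum_coe]

instance isProbabilityMeasure_lastIterateLaw (η lam : ℕ → ℝ) (P : PMF (Schedule T n)) :
    IsProbabilityMeasure (lastIterateLaw ℓ β₀ η lam T P S) := by
  constructor
  simp only [lastIterateLaw, Measure.finsetSum_apply, Measure.smul_apply, measure_univ,
    smul_eq_mul, mul_one, sum_pmf_eq_one]

end SinglePass

end SGLD

theorem mainTheorem6 {d n T : ℕ} (hT : 1 ≤ T) {Z : Type*}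
    (ℓ : EuclideanSpace ℝ (Fin d) → Z → ℝ) (G η β₀ α : ℝ) (L : NNReal)
    (hconv : ∀ z, ConvexOn ℝ Set.univ (fun w => ℓ w z))
    (hdiff : ∀ z, Differentiable ℝ (fun w => ℓ w z))
    (hG : ∀ w z, ‖gradient (fun u => ℓ u z) w‖ ≤ G)
    (hL : ∀ z, LipschitzWith L (gradient (fun w => ℓ w z)))
    (hη : 0 < η) (hηL : η * (L : ℝ) ≤ 2) (hβ₀ : 0 < β₀) (hα : 1 < α)
    (P : PMF (SGLD.Schedule T n))
    (hP : ∀ M, P M ≠ 0 → M.IsSinglePass) :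
    SGLD.IsRenyiDP α (2 * α * η ^ 2 * G ^ 2 / β₀)
      (fun S : Fin n → Z =>
        SGLD.lastIterateLaw ℓ β₀ (fun _ => η) (fun t => 1 / ((t : ℝ) * η)) T P S) := by
  have hstep : ∀ z, LipschitzWith 1 fun w => w - η • gradient (fun u => ℓ u z) w := fun z =>
    SGLD.lipschitzWith_one_sub_smul_gradient (hconv z) (hdiff z) (hL z) hη.le hηL
  refine ⟨fun S => inferInstance, fun S S' hSS' => SGLD.RenyiDominated.renyiDiv_le hα ?_⟩
  exact SGLD.RenyiDominated.sum_smul hα (SGLD.sum_pmf_eq_one P) fun M hM =>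
    (hP M hM).renyiDominated_iterateLaw hα hβ₀ hη hstep hG hSS'
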